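/- All Banach spaces are over the same scalar field ($\mathbb R$ or $\mathbb C$), and subspaces of Banach spaces are closed. A Banach space $Z$ has the uniform approximation property (UAP) if there are $\lambda<\infty$ and a function $f:\mathbb N\to\mathbb N$ such that for every finite-dimensional subspace $A\subseteq Z$ there is a finite-rank bounded operator $u:Z\to Z$ with $u|_A=\mathrm{id}_A$, $\|u\|<\lambda$ and $\dim u(Z)\le f(\dim A)$. A Banach space $Y$ is finitely representable in $Z$ if for every $\varepsilon>0$ and every finite-dimensional subspace $A\subseteq Y$ there are a subspace $B\subseteq Z$ and an isomorphism $u:A\to B$ with $\|u\|\,\|u^{-1}\|<1+\varepsilon$. $Z^f$ denotes the class of all Banach spaces $W$ such that $W$ is finitely representable in $Z$ and $Z$ is finitely representable in $W$. Let $d(W,V)=\inf\{\|u\|\,\|u^{-1}\| : u:W\to V \text{ an isomorphism}\}$ be the Banach–Mazur distance ($\inf\varnothing=\infty$). A Banach space $W$ is finitely decomposable if there is a constant $C<\infty$ such that for every subspace $W'\subseteq W$ of finite codimension there is a Banach space $V$ with $d(W,V)<C$ which is finitely representable in $W'$. The class $Z^f$ is finitely decomposable if it contains a finitely decomposable space.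 **Theorem.** Let $X,Y,Z$ be Banach spaces such that $Z$ has the UAP, $Y$ is finitely representable in $Z$, and the class $Z^f$ is finitely decomposable. Then for every compact operator $T:X\to Y$ there are a subspace $W_0$ of $Z$ and compact operators $u:X\to W_0$, $v:W_0\to Y$ with $T=v\circ u$. -/

import Mathlib

open scoped ENNReal NNReal

/-- `X` has the `lam`-uniform approximation property: there is `f : ℕ → ℕ` such that every
finite dimensional subspace `A` of `X` is fixed pointwise by some bounded operator on `X` of norm
less than `lam` and of finite rank at most `f (dim A)`. -/
def HasUAPWith (𝕜 : Type*) [RCLike 𝕜] (X : Type*) [NormedAddCommGroup X] [NormedSpace 𝕜 X]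
    (lam : ℝ) : Prop :=
  ∃ f : ℕ → ℕ, ∀ A : Submodule 𝕜 X, FiniteDimensional 𝕜 A →
    ∃ u : X →L[𝕜] X, (∀ a ∈ A, u a = a) ∧ ‖u‖ < lam ∧
      FiniteDimensional 𝕜 (LinearMap.range (u : X →ₗ[𝕜] X)) ∧
      Module.finrank 𝕜 (LinearMap.range (u : X →ₗ[𝕜] X)) ≤ f (Module.finrank 𝕜 A)

/-- The uniform approximation property. -/
def HasUAP (𝕜 : Type*) [RCLike 𝕜] (X : Type*) [NormedAddCommGroup X] [NormedSpace 𝕜 X] : Prop :=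
  ∃ lam : ℝ, HasUAPWith 𝕜 X lam

/-- `Y` is finitely representable in `X`. -/
def FinRep (𝕜 : Type*) [RCLike 𝕜] (Y : Type*) [NormedAddCommGroup Y] [NormedSpace 𝕜 Y]
    (X : Type*) [NormedAddCommGroup X] [NormedSpace 𝕜 X] : Prop :=
  ∀ ε : ℝ, 0 < ε → ∀ A : Submodule 𝕜 Y, FiniteDimensional 𝕜 A →
    ∃ (B : Submodule 𝕜 X) (u : A ≃L[𝕜] B),
      ‖(u : A →L[𝕜] B)‖ * ‖(u.symm : B →L[𝕜] A)‖ < 1 + ε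

/-- Finite equivalence of `X` and `Y`; `X^f` is the class of Banach spaces finitely equivalent
to `X`. -/
def FinEquiv (𝕜 : Type*) [RCLike 𝕜] (X : Type*) [NormedAddCommGroup X] [NormedSpace 𝕜 X]
    (Y : Type*) [NormedAddCommGroup Y] [NormedSpace 𝕜 Y] : Prop :=
  FinRep 𝕜 X Y ∧ FinRep 𝕜 Y X

/-- The Banach-Mazur distance (`∞` if the spaces are not isomorphic). -/
noncomputable def bmDist (𝕜 : Type*) [RCLike 𝕜] (X : Type*) [NormedAddCommGroup X]
    [NormedSpace 𝕜 X] (Y : Type*) [NormedAddCommGroup Y] [NormedSpace 𝕜 Y] : ℝ≥0∞ :=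
  ⨅ u : X ≃L[𝕜] Y, ENNReal.ofReal (‖(u : X →L[𝕜] Y)‖ * ‖(u.symm : Y →L[𝕜] X)‖)

/-- `X` is finitely decomposable: there is a constant `C < ∞` such that for every closed subspace
`V` of finite codimension in `X` some Banach space `Y` at Banach-Mazur distance less than `C`
from `X` is finitely representable in `V`. -/
def FinDecomposable.{a, b} (𝕜 : Type a) [RCLike 𝕜] (X : Type b) [NormedAddCommGroup X]
    [NormedSpace 𝕜 X] : Prop :=
  ∃ C : ℝ≥0, ∀ V : Submodule 𝕜 X, IsClosed (V : Set X) → FiniteDimensional 𝕜 (X ⧸ V) →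
    ∃ (Y : Type b) (_ : NormedAddCommGroup Y) (_ : NormedSpace 𝕜 Y) (_ : CompleteSpace Y),
      bmDist 𝕜 X Y < C ∧ FinRep 𝕜 Y V

/-- The class `X^f` is finitely decomposable: it is generated by a finitely decomposable Banach
space, i.e. some Banach space finitely equivalent to `X` is finitely decomposable. -/
def FinDecomposableClass.{a, b} (𝕜 : Type a) [RCLike 𝕜] (X : Type b) [NormedAddCommGroup X]
    [NormedSpace 𝕜 X] : Prop :=
  ∃ (W : Type b) (_ : NormedAddCommGroup W) (_ : NormedSpace 𝕜 W) (_ : CompleteSpace W),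
    FinEquiv 𝕜 X W ∧ FinDecomposable 𝕜 W

/-- `T : X → Y` has a `K`-factorization through `W`: it is `v ∘ u` with compact operators
`u : X → W` and `v : W → Y`. -/
def HasKFactorization {𝕜 : Type*} [RCLike 𝕜] {X : Type*} [NormedAddCommGroup X]
    [NormedSpace 𝕜 X] {Y : Type*} [NormedAddCommGroup Y] [NormedSpace 𝕜 Y] (T : X →L[𝕜] Y)
    (W : Type*) [NormedAddCommGroup W] [NormedSpace 𝕜 W] : Prop :=
  ∃ (u : X →L[𝕜] W) (v : W →L[𝕜] Y),
    IsCompactOperator u ∧ IsCompactOperator v ∧ v.comp u = T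

/-! `Y` embeds by some `J` into an ultrapower `H` of `Z`. Operators given by the UAP have ranks
bounded in terms of the dimension alone, so along the ultrafilter they induce finite-rank operators
on `H`; hence `J ∘ T`, being compact, is a norm limit of finite-rank operators and a series `∑ S n`
with `‖S n‖ ≤ M / 4 ^ n` (`exists_series_of_approx`).

The ranges of the `S n` embed uniformly in `Z`, hence in the finitely decomposable space `W` of
`Z^f`, hence in every finite-codimensional subspace of `W`; `FinRep.kEmbeds_finiteCodimension`
brings this property back to `Z`. A gliding choice with Mazur's lemma (`exists_decomposition`) then
gives copies `e n` of these ranges forming a Schauder decomposition in `Z`.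

Put `u = ∑ 2 ^ n e n (S n)`. The coordinates `S n x` depend on `u x` with norm `O(2 ^ (-n))`, so
their sum is a compact `v` on the closure of the range of `u`, with `v ∘ u = J ∘ T`; inverting `J`
on its range finishes the proof. -/

/-- `E` embeds linearly in `F` with distortion at most `K`. -/
def KEmbeds (𝕜 : Type*) [RCLike 𝕜] (K : ℝ) (E : Type*) [NormedAddCommGroup E] [NormedSpace 𝕜 E]
    (F : Type*) [NormedAddCommGroup F] [NormedSpace 𝕜 F] : Prop :=
  ∃ g : E →ₗ[𝕜] F, ∀ x, ‖x‖ ≤ ‖g x‖ ∧ ‖g x‖ ≤ K * ‖x‖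

/-! ### Embeddings with controlled distortion -/

section Embeddings

variable {𝕜 : Type*} [RCLike 𝕜]
  {E : Type*} [NormedAddCommGroup E] [NormedSpace 𝕜 E]
  {A : Type*} [NormedAddCommGroup A] [NormedSpace 𝕜 A]
  {B : Type*} [NormedAddCommGroup B] [NormedSpace 𝕜 B]
  {F : Type*} [NormedAddCommGroup F] [NormedSpace 𝕜 F]

/-- Scaling `u` by `‖u⁻¹‖` restores the lower bound `1` that `KEmbeds` demands. -/
theorem KEmbeds.of_equiv {K c : ℝ} (h : KEmbeds 𝕜 K E A) (u : A ≃L[𝕜] B)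
    (hu : ‖(u : A →L[𝕜] B)‖ * ‖(u.symm : B →L[𝕜] A)‖ ≤ c) : KEmbeds 𝕜 (c * K) E B := by
  obtain ⟨g, hg⟩ := h
  refine ⟨(‖(u.symm : B →L[𝕜] A)‖ : 𝕜) • ((u : A →ₗ[𝕜] B) ∘ₗ g), fun x => ?_⟩
  have h1 : ‖((‖(u.symm : B →L[𝕜] A)‖ : 𝕜) • ((u : A →ₗ[𝕜] B) ∘ₗ g)) x‖
      = ‖(u.symm : B →L[𝕜] A)‖ * ‖u (g x)‖ := by
    simp [norm_smul]
  rw [h1]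
  have h2 := (u.symm : B →L[𝕜] A).le_opNorm (u (g x))
  have h3 := (u : A →L[𝕜] B).le_opNorm (g x)
  simp only [ContinuousLinearEquiv.coe_coe, ContinuousLinearEquiv.symm_apply_apply] at h2 h3
  refine ⟨(hg x).1.trans h2, ?_⟩
  calc ‖(u.symm : B →L[𝕜] A)‖ * ‖u (g x)‖
      ≤ ‖(u.symm : B →L[𝕜] A)‖ * (‖(u : A →L[𝕜] B)‖ * ‖g x‖) := by gcongr
    _ = (‖(u : A →L[𝕜] B)‖ * ‖(u.symm : B →L[𝕜] A)‖) * ‖g x‖ := by ring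
    _ ≤ c * ‖g x‖ := by gcongr
    _ ≤ c * (K * ‖x‖) :=
        mul_le_mul_of_nonneg_left (hg x).2 (le_trans (by positivity) hu)
    _ = c * K * ‖x‖ := by ring

theorem KEmbeds.of_subspace {K : ℝ} {V : Submodule 𝕜 F} (h : KEmbeds 𝕜 K E V) :
    KEmbeds 𝕜 K E F := by
  obtain ⟨g, hg⟩ := h
  exact ⟨V.subtype ∘ₗ g, hg⟩

theorem KEmbeds.rangeRestrict {K : ℝ} {g : E →ₗ[𝕜] F}
    (hg : ∀ x, ‖x‖ ≤ ‖g x‖ ∧ ‖g x‖ ≤ K * ‖x‖) : KEmbeds 𝕜 K E (LinearMap.range g) :=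
  ⟨g.rangeRestrict, hg⟩

theorem FinRep.kEmbeds [FiniteDimensional 𝕜 E] (h : FinRep 𝕜 A B) {K : ℝ}
    (hE : KEmbeds 𝕜 K E A) : KEmbeds 𝕜 (2 * K) E B := by
  obtain ⟨g, hg⟩ := hE
  obtain ⟨S, u, hu⟩ := h 1 one_pos (LinearMap.range g) inferInstance
  exact ((KEmbeds.rangeRestrict hg).of_equiv u (by linarith)).of_subspace

theorem KEmbeds.of_bmDist_lt {C : ℝ≥0} (hd : bmDist 𝕜 A B < C) {K : ℝ}
    (hE : KEmbeds 𝕜 K E A) : KEmbeds 𝕜 (C * K) E B := by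
  obtain ⟨u, hu⟩ := iInf_lt_iff.1 hd
  refine hE.of_equiv u ?_
  have := (ENNReal.ofReal_lt_coe_iff (by positivity)).1 hu
  exact this.le

end Embeddings

/-- The point is that `C` depends neither on `E` nor on `V`. The factor 2 is the cost of finite
representability with `ε = 1`. -/
theorem FinDecomposable.exists_kEmbeds.{a, b, c} {𝕜 : Type a} [RCLike 𝕜] {W : Type b}
    [NormedAddCommGroup W] [NormedSpace 𝕜 W] (h : FinDecomposable 𝕜 W) :
    ∃ C : ℝ, 0 ≤ C ∧ ∀ (E : Type c) [NormedAddCommGroup E] [NormedSpace 𝕜 E]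
      [FiniteDimensional 𝕜 E] (K : ℝ), KEmbeds 𝕜 K E W →
      ∀ V : Submodule 𝕜 W, IsClosed (V : Set W) → FiniteDimensional 𝕜 (W ⧸ V) →
        KEmbeds 𝕜 (C * K) E V := by
  obtain ⟨C, hC⟩ := h
  refine ⟨2 * C, by positivity, fun E _ _ _ K hE V hV hV' => ?_⟩
  obtain ⟨Y, _, _, _, hd, hr⟩ := hC V hV hV'
  have := hr.kEmbeds (hE.of_bmDist_lt hd)
  rwa [← mul_assoc] at this

/-! ### Mazur's lemma and a pigeonhole principle -/

section FiniteCodimension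

variable {𝕜 : Type*} [RCLike 𝕜] {Z : Type*} [NormedAddCommGroup Z] [NormedSpace 𝕜 Z]

theorem finiteDimensional_quotient_inf {V V' : Submodule 𝕜 Z} (h : FiniteDimensional 𝕜 (Z ⧸ V))
    (h' : FiniteDimensional 𝕜 (Z ⧸ V')) : FiniteDimensional 𝕜 (Z ⧸ (V ⊓ V')) := by
  have hk : V ⊓ V' = LinearMap.ker (V.mkQ.prod V'.mkQ) := by
    rw [LinearMap.ker_prod, Submodule.ker_mkQ, Submodule.ker_mkQ]
  rw [hk]
  exact (LinearMap.quotKerEquivRange _).symm.finiteDimensional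

/-- Mazur's lemma: a finite dimensional subspace is almost orthogonal to some closed subspace of
finite codimension. -/
theorem exists_almost_orthogonal (G : Submodule 𝕜 Z) [FiniteDimensional 𝕜 G] :
    ∃ V : Submodule 𝕜 Z, IsClosed (V : Set Z) ∧ FiniteDimensional 𝕜 (Z ⧸ V) ∧
      ∀ g ∈ G, ∀ v ∈ V, ‖g‖ ≤ 2 * ‖g + v‖ := by
  have : ProperSpace G := FiniteDimensional.proper 𝕜 G
  obtain ⟨t, htf, ht⟩ := Metric.totallyBounded_iff.1
    (isCompact_sphere (0 : G) 1).totallyBounded (1 / 4) (by norm_num)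
  have := htf.fintype
  -- `V` will be the common kernel of norming functionals for a finite `1/4`-net of the unit sphere
  -- of `G`; the two errors `1/4` leave `‖g + v‖ ≥ 1/2`.
  choose φ hφ hφ' using fun z : Z => exists_dual_vector'' 𝕜 z
  let Φ : Z →L[𝕜] (t → 𝕜) := ContinuousLinearMap.pi fun y => φ (y : G)
  refine ⟨LinearMap.ker (Φ : Z →ₗ[𝕜] (t → 𝕜)), Φ.isClosed_ker,
    (LinearMap.quotKerEquivRange _).symm.finiteDimensional, ?_⟩
  have key : ∀ g ∈ G, ‖g‖ = 1 → ∀ v ∈ LinearMap.ker (Φ : Z →ₗ[𝕜] (t → 𝕜)),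
      1 / 2 ≤ ‖g + v‖ := by
    intro g hg hg1 v hv
    obtain ⟨y, hy, hgy⟩ := Set.mem_iUnion₂.1 (ht (a := ⟨g, hg⟩) (by simpa using hg1))
    have hv0 : φ (y : Z) v = 0 := congrFun (LinearMap.mem_ker.1 hv) ⟨y, hy⟩
    have hd : ‖g - (y : Z)‖ ≤ 1 / 4 := by
      rw [Metric.mem_ball, dist_eq_norm] at hgy
      exact hgy.le
    have h1 : (‖(y : Z)‖ : 𝕜) = φ (y : Z) (g + v) - φ (y : Z) (g - y) := by
      rw [map_sub, map_add, hφ', hv0]; ring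
    have h2 : ‖(y : Z)‖ ≤ ‖g + v‖ + ‖g - (y : Z)‖ := by
      calc ‖(y : Z)‖ = ‖(‖(y : Z)‖ : 𝕜)‖ := by simp
        _ ≤ ‖φ (y : Z) (g + v)‖ + ‖φ (y : Z) (g - y)‖ := h1 ▸ norm_sub_le _ _
        _ ≤ ‖g + v‖ + ‖g - (y : Z)‖ := by
          gcongr
          · exact (φ (y : Z)).le_of_opNorm_le (hφ _) _ |>.trans_eq (one_mul _)
          · exact (φ (y : Z)).le_of_opNorm_le (hφ _) _ |>.trans_eq (one_mul _)
    have h3 := norm_sub_norm_le g (y : Z)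
    linarith
  intro g hg v hv
  rcases eq_or_ne g 0 with rfl | hg0
  · simp
  have hn : (0 : ℝ) < ‖g‖ := norm_pos_iff.2 hg0
  have h := key (((‖g‖⁻¹ : ℝ) : 𝕜) • g) (G.smul_mem _ hg) (by
    rw [norm_smul, RCLike.norm_ofReal, abs_of_pos (by positivity)]
    field_simp) (((‖g‖⁻¹ : ℝ) : 𝕜) • v) (Submodule.smul_mem _ _ hv)
  rw [← smul_add, norm_smul, RCLike.norm_ofReal, abs_of_pos (by positivity)] at h
  rw [inv_mul_eq_div, le_div_iff₀ hn] at h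
  linarith

/-- Balls of `F` are totally bounded: with more vectors than points of a `δ/2`-net, two of them
share a net point. -/
theorem exists_pair_norm_sub_le {F : Type*} [NormedAddCommGroup F] [NormedSpace 𝕜 F]
    [FiniteDimensional 𝕜 F] (B : ℝ) {δ : ℝ} (hδ : 0 < δ) :
    ∃ N : ℕ, ∀ a : ℕ → F, (∀ i < N, ‖a i‖ ≤ B) → ∃ i j, i < j ∧ j < N ∧ ‖a i - a j‖ ≤ δ := by
  have : ProperSpace F := FiniteDimensional.proper 𝕜 F
  obtain ⟨t, htf, ht⟩ := Metric.totallyBounded_iff.1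
    (isCompact_closedBall (0 : F) B).totallyBounded (δ / 2) (by positivity)
  refine ⟨htf.toFinset.card + 1, fun a ha => ?_⟩
  have hc : ∀ i, ∃ y : F, i ∈ Finset.range (htf.toFinset.card + 1) →
      y ∈ htf.toFinset ∧ ‖a i - y‖ < δ / 2 := by
    intro i
    by_cases hi : i ∈ Finset.range (htf.toFinset.card + 1)
    · obtain ⟨y, hy, hay⟩ := Set.mem_iUnion₂.1
        (ht (a := a i) (by simpa using ha i (Finset.mem_range.1 hi)))
      rw [Metric.mem_ball, dist_eq_norm] at hay
      exact ⟨y, fun _ => ⟨htf.mem_toFinset.2 hy, hay⟩⟩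
    · exact ⟨0, fun h => absurd h hi⟩
  choose y hy using hc
  obtain ⟨i, hi, j, hj, hij, hyij⟩ := Finset.exists_ne_map_eq_of_card_lt_of_maps_to
    (s := Finset.range (htf.toFinset.card + 1)) (t := htf.toFinset) (by simp)
    (f := y) (fun i hi => (hy i hi).1)
  have key : ‖a i - a j‖ ≤ δ := by
    have h1 := (hy i hi).2
    have h2 := (hy j hj).2
    rw [← hyij, norm_sub_rev] at h2
    have h3 := norm_add_le (a i - y i) (y i - a j)
    rw [sub_add_sub_cancel] at h3
    linarith
  rcases lt_or_gt_of_ne hij with h | h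
  · exact ⟨i, j, h, Finset.mem_range.1 hj, key⟩
  · exact ⟨j, i, h, Finset.mem_range.1 hi, by rwa [norm_sub_rev]⟩

end FiniteCodimension

/-! ### Gliding copies in finite-codimensional subspaces -/

section Chain

variable {𝕜 : Type*} [RCLike 𝕜] {Z : Type*} [NormedAddCommGroup Z] [NormedSpace 𝕜 Z]

/-- If every closed subspace of finite codimension contains uniform copies of all `E n`, then
copies of the `E n` can be chosen so that they form a Schauder decomposition of their span. -/
theorem exists_decomposition {E : ℕ → Type*} [∀ n, NormedAddCommGroup (E n)]
    [∀ n, NormedSpace 𝕜 (E n)] [∀ n, FiniteDimensional 𝕜 (E n)] {C : ℝ}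
    (h : ∀ n, ∀ V : Submodule 𝕜 Z, IsClosed (V : Set Z) → FiniteDimensional 𝕜 (Z ⧸ V) →
      KEmbeds 𝕜 C (E n) V) :
    ∃ e : ∀ n, E n →ₗ[𝕜] Z, (∀ n x, ‖x‖ ≤ ‖e n x‖ ∧ ‖e n x‖ ≤ C * ‖x‖) ∧
      ∀ x : ∀ n, E n, ∀ n m, n ≤ m → ‖∑ k ∈ Finset.range n, e k (x k)‖ ≤
        2 * ‖∑ k ∈ Finset.range m, e k (x k)‖ := by
  -- A state `(V, G)`: `G` contains all copies chosen so far, and all later copies lie in `V`, which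
  -- is almost orthogonal to `G`.
  let S := {p : Submodule 𝕜 Z × Submodule 𝕜 Z // IsClosed (p.1 : Set Z) ∧
    FiniteDimensional 𝕜 (Z ⧸ p.1) ∧ FiniteDimensional 𝕜 p.2 ∧
    ∀ g ∈ p.2, ∀ v ∈ p.1, ‖g‖ ≤ 2 * ‖g + v‖}
  have step : ∀ n (s : S), ∃ (t : S) (e : E n →ₗ[𝕜] Z),
      (∀ x, ‖x‖ ≤ ‖e x‖ ∧ ‖e x‖ ≤ C * ‖x‖) ∧ (∀ x, e x ∈ s.1.1) ∧ t.1.1 ≤ s.1.1 ∧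
      s.1.2 ≤ t.1.2 ∧ ∀ x, e x ∈ t.1.2 := by
    rintro n ⟨⟨V, G⟩, hV, hV', hG, hVG⟩
    obtain ⟨g, hg⟩ := h n V hV hV'
    have hfd : FiniteDimensional 𝕜 G := hG
    let G' : Submodule 𝕜 Z := G ⊔ LinearMap.range (V.subtype ∘ₗ g)
    obtain ⟨V', hV1, hV2, hV3⟩ := exists_almost_orthogonal G'
    exact ⟨⟨(V ⊓ V', G'), hV.inter hV1, finiteDimensional_quotient_inf hV' hV2, inferInstance,
      fun g hg v hv => hV3 g hg v hv.2⟩, V.subtype ∘ₗ g, hg, fun x => (g x).2, inf_le_left,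
      le_sup_left, fun x => (le_sup_right : _ ≤ G') (LinearMap.mem_range_self _ x)⟩
  choose next e he1 he2 hV hG he3 using step
  have hfq : FiniteDimensional 𝕜 (Z ⧸ (⊤ : Submodule 𝕜 Z)) := inferInstance
  let s₀ : S := ⟨(⊤, ⊥), isClosed_univ, hfq, inferInstanceAs
    (FiniteDimensional 𝕜 (⊥ : Submodule 𝕜 Z)), by
      intro g hg v _
      rw [Submodule.mem_bot] at hg
      simp [hg]⟩
  let s : ℕ → S := fun n => Nat.rec s₀ (fun n t => next n t) n
  have hVa : Antitone fun n => (s n).1.1 := antitone_nat_of_succ_le fun n => hV n (s n)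
  have hGm : Monotone fun n => (s n).1.2 := monotone_nat_of_le_succ fun n => hG n (s n)
  refine ⟨fun n => e n (s n), fun n => he1 n (s n), fun x n m hnm => ?_⟩
  -- The head of the sum lies in the `n`-th `G` and the tail in the `n`-th `V`.
  rw [← Finset.sum_range_add_sum_Ico _ hnm]
  refine (s n).2.2.2.2 _ (Submodule.sum_mem _ fun k hk => ?_) _
    (Submodule.sum_mem _ fun k hk => ?_)
  · exact hGm (Nat.succ_le_of_lt (Finset.mem_range.1 hk)) (he3 k (s k) (x k))
  · exact hVa (Finset.mem_Ico.1 hk).1 (he2 k (s k) (x k))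

theorem KEmbeds.exists_pairwise_copies {W : Type*} [NormedAddCommGroup W] [NormedSpace 𝕜 W]
    {E : Type*} [NormedAddCommGroup E] [NormedSpace 𝕜 E] [FiniteDimensional 𝕜 E] {C : ℝ}
    (h : ∀ V : Submodule 𝕜 W, IsClosed (V : Set W) → FiniteDimensional 𝕜 (W ⧸ V) →
      KEmbeds 𝕜 C E V) :
    ∃ e : ℕ → E →ₗ[𝕜] W, (∀ n x, ‖e n x‖ ≤ C * ‖x‖) ∧
      ∀ i j, i < j → ∀ x, ‖x‖ ≤ 2 * ‖e i x - e j x‖ := by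
  obtain ⟨e, he, hs⟩ := exists_decomposition (E := fun _ => E) (fun _ => h)
  refine ⟨e, fun n x => (he n x).2, fun i j hij x => (he i x).1.trans ?_⟩
  -- Coordinates `x` at `i` and `-x` at `j`: the partial sums up to `i` and up to `j` are `e i x`
  -- and `e i x - e j x`.
  have := hs (fun k => if k = i then x else if k = j then -x else 0) (i + 1) (j + 1) (by omega)
  have hsum : (fun k => e k (if k = i then x else if k = j then -x else 0)) =
      fun k => (if k = i then e i x else 0) + (if k = j then -e j x else 0) := by
    funext k
    split_ifs with h1 h2 h2
    · omega
    · subst h1; simp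
    · subst h2; simp
    · simp
  simp only [hsum, Finset.sum_add_distrib, Finset.sum_ite_eq', Finset.mem_range] at this
  simpa [hij.le, Nat.lt_succ_of_lt hij, show ¬ j < i + 1 by omega, sub_eq_add_neg] using this

/-- Uniform containment of `E` in the subspaces of finite codimension passes from `W` to any space
in which `W` is finitely representable. -/
theorem FinRep.kEmbeds_finiteCodimension {W : Type*} [NormedAddCommGroup W] [NormedSpace 𝕜 W]
    {E : Type*} [NormedAddCommGroup E] [NormedSpace 𝕜 E] [FiniteDimensional 𝕜 E] {C : ℝ}
    (hC : 0 ≤ C) (hWZ : FinRep 𝕜 W Z)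
    (h : ∀ V : Submodule 𝕜 W, IsClosed (V : Set W) → FiniteDimensional 𝕜 (W ⧸ V) →
      KEmbeds 𝕜 C E V)
    (V : Submodule 𝕜 Z) (hV : IsClosed (V : Set Z)) (hV' : FiniteDimensional 𝕜 (Z ⧸ V)) :
    KEmbeds 𝕜 (16 * C + 1) E V := by
  obtain ⟨e, he, hsep⟩ := KEmbeds.exists_pairwise_copies h
  obtain ⟨p, hp⟩ := Submodule.ClosedComplemented.of_finiteDimensional_quotient hV
  -- `q` is the finite-rank projection with kernel `V`; it measures the failure to lie in `V`.
  let q : Z →L[𝕜] Z := ContinuousLinearMap.id 𝕜 Z - V.subtypeL.comp p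
  have hq : ∀ z, (p z : Z) = z - q z := fun z => by simp [q]
  have hker : LinearMap.ker (q : Z →ₗ[𝕜] Z) = V := by
    ext z
    have hz : q z = z - p z := by simp [q]
    rw [LinearMap.mem_ker, ContinuousLinearMap.coe_coe, hz, sub_eq_zero]
    refine ⟨fun h => h ▸ (p z).2, fun h => ?_⟩
    rw [hp ⟨z, h⟩]
  have hR : FiniteDimensional 𝕜 (LinearMap.range (q : Z →ₗ[𝕜] Z)) := by
    rw [← hker] at hV'
    exact (LinearMap.quotKerEquivRange _).finiteDimensional
  -- Among `N` copies of `E` carried to `Z`, two have nearly equal images under `q`, so their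
  -- difference nearly maps into `V`.
  obtain ⟨N, hN⟩ := exists_pair_norm_sub_le (𝕜 := 𝕜)
    (F := E →L[𝕜] LinearMap.range (q : Z →ₗ[𝕜] Z)) (‖q‖ * (2 * C)) (δ := 1 / 4) (by norm_num)
  let G : Submodule 𝕜 W := ⨆ i : Fin N, LinearMap.range (e i)
  have heG : ∀ i < N, ∀ x, e i x ∈ G := fun i hi x =>
    le_iSup (fun i : Fin N => LinearMap.range (e i)) ⟨i, hi⟩ (LinearMap.mem_range_self _ x)
  obtain ⟨h₀, hh₀⟩ := hWZ.kEmbeds (E := G) (K := 1) ⟨G.subtype, fun x => by simp⟩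
  obtain ⟨h', hh'⟩ := LinearMap.exists_extend h₀
  have hb : ∀ w ∈ G, ‖w‖ ≤ ‖h' w‖ ∧ ‖h' w‖ ≤ 2 * ‖w‖ := fun w hw => by
    have h1 := hh₀ ⟨w, hw⟩
    rw [← hh'] at h1
    simpa using h1
  let a : ℕ → E →L[𝕜] LinearMap.range (q : Z →ₗ[𝕜] Z) := fun i =>
    LinearMap.toContinuousLinearMap
      ((q : Z →ₗ[𝕜] Z).rangeRestrict ∘ₗ h' ∘ₗ e i)
  obtain ⟨i, j, hij, hj, hd⟩ := hN a fun i hi => by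
    refine ContinuousLinearMap.opNorm_le_bound _ (by positivity) fun x => ?_
    change ‖q (h' (e i x))‖ ≤ _
    calc ‖q (h' (e i x))‖ ≤ ‖q‖ * ‖h' (e i x)‖ := q.le_opNorm _
      _ ≤ ‖q‖ * (2 * (C * ‖x‖)) := by
        gcongr
        exact (hb _ (heG i hi x)).2.trans (by linarith [he i x])
      _ = ‖q‖ * (2 * C) * ‖x‖ := by ring
  have hi : i < N := hij.trans hj
  -- Lower bound `4 (1/2 - 1/4) = 1`; upper bound `4 (2 · 2C + 1/4) = 16 C + 1`.
  refine ⟨(4 : 𝕜) • ((p : Z →ₗ[𝕜] V) ∘ₗ h' ∘ₗ (e i - e j)), fun x => ?_⟩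
  have hn : ‖((4 : 𝕜) • ((p : Z →ₗ[𝕜] V) ∘ₗ h' ∘ₗ (e i - e j))) x‖ =
      4 * ‖h' (e i x - e j x) - q (h' (e i x - e j x))‖ := by
    rw [← hq]
    simp [norm_smul]
  have h1 := hb _ (G.sub_mem (heG i hi x) (heG j hj x))
  have h2 := hsep i j hij x
  have h3 : ‖q (h' (e i x - e j x))‖ ≤ 1 / 4 * ‖x‖ := by
    have := (a i - a j).le_of_opNorm_le hd x
    change ‖q (h' (e i x)) - q (h' (e j x))‖ ≤ _ at this
    rwa [← map_sub, ← map_sub] at this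
  have h4 : ‖e i x - e j x‖ ≤ C * ‖x‖ + C * ‖x‖ :=
    (norm_sub_le _ _).trans (add_le_add (he i x) (he j x))
  have h5 := norm_sub_norm_le (h' (e i x - e j x)) (q (h' (e i x - e j x)))
  have h6 := norm_sub_le (h' (e i x - e j x)) (q (h' (e i x - e j x)))
  rw [hn]
  constructor <;> linarith

end Chain

/-! ### Ultrapowers: norms, local structure, approximation property, embeddings -/

section Ultrapower

open Filter Topology

variable (𝕜 : Type*) [RCLike 𝕜] {ι : Type*} (U : Ultrafilter ι)
  (Z : Type*) [NormedAddCommGroup Z] [NormedSpace 𝕜 Z]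

/-- The bounded families converging to `0` along `U`. -/
def nullFamilies : Submodule 𝕜 (lp (fun _ : ι => Z) ∞) where
  carrier := {x | Tendsto (fun i => x i) U (𝓝 0)}
  zero_mem' := tendsto_const_nhds
  add_mem' := fun {x y} hx hy => by
    simpa using Tendsto.add (f := fun i => x i) (g := fun i => y i) hx hy
  smul_mem' := fun c x hx => by
    simpa using Tendsto.const_smul (f := fun i => x i) hx c

variable {U Z}

theorem mem_nullFamilies {x : lp (fun _ : ι => Z) ∞} :
    x ∈ nullFamilies 𝕜 U Z ↔ Tendsto (fun i => x i) U (𝓝 0) := Iff.rfl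

theorem isClosed_nullFamilies : IsClosed (nullFamilies 𝕜 U Z : Set (lp (fun _ : ι => Z) ∞)) := by
  refine isClosed_of_closure_subset fun x hx => ?_
  rw [SetLike.mem_coe, mem_nullFamilies, Metric.tendsto_nhds]
  intro ε hε
  obtain ⟨y, hy, hxy⟩ := Metric.mem_closure_iff.1 hx (ε / 2) (by positivity)
  filter_upwards [Metric.tendsto_nhds.1 hy (ε / 2) (by positivity)] with i hi
  have h1 := lp.norm_apply_le_norm ENNReal.top_ne_zero (x - y) i
  rw [dist_eq_norm] at hxy
  rw [dist_zero_right] at hi ⊢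
  have h2 := norm_add_le (x i - y i) (y i)
  rw [sub_add_cancel] at h2
  simp only [lp.coeFn_sub, Pi.sub_apply] at h1
  linarith

instance : IsClosed (nullFamilies 𝕜 U Z : Set (lp (fun _ : ι => Z) ∞)) := isClosed_nullFamilies 𝕜

variable (U Z) in
/-- The ultrapower of `Z` along `U`. -/
def Ultrapower := lp (fun _ : ι => Z) ∞ ⧸ nullFamilies 𝕜 U Z

namespace Ultrapower

noncomputable instance : NormedAddCommGroup (Ultrapower 𝕜 U Z) :=
  Submodule.Quotient.normedAddCommGroup (nullFamilies 𝕜 U Z)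

noncomputable instance : NormedSpace 𝕜 (Ultrapower 𝕜 U Z) :=
  Submodule.Quotient.normedSpace (nullFamilies 𝕜 U Z) 𝕜

instance [CompleteSpace Z] : CompleteSpace (Ultrapower 𝕜 U Z) :=
  Submodule.Quotient.completeSpace (nullFamilies 𝕜 U Z)

variable (U) in
/-- The class of a bounded family in the ultrapower. -/
noncomputable def mk : lp (fun _ : ι => Z) ∞ →ₗ[𝕜] Ultrapower 𝕜 U Z :=
  (nullFamilies 𝕜 U Z).mkQ

theorem mk_surjective : Function.Surjective (mk 𝕜 U : lp (fun _ : ι => Z) ∞ →ₗ[𝕜] _) :=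
  Submodule.mkQ_surjective _

theorem mk_eq_zero {x : lp (fun _ : ι => Z) ∞} :
    mk 𝕜 U x = 0 ↔ Tendsto (fun i => x i) U (𝓝 0) :=
  Submodule.Quotient.mk_eq_zero _

theorem mk_eq_mk {x y : lp (fun _ : ι => Z) ∞} :
    mk 𝕜 U x = mk 𝕜 U y ↔ Tendsto (fun i => x i - y i) U (𝓝 0) := by
  rw [← sub_eq_zero, ← map_sub, mk_eq_zero]
  rfl

theorem norm_mk_le {x : lp (fun _ : ι => Z) ∞} {c : ℝ} (h : ∀ᶠ i in (U : Filter ι), ‖x i‖ ≤ c) :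
    ‖(mk 𝕜 U x)‖ ≤ c := by
  classical
  have hc : 0 ≤ c := by
    obtain ⟨i, hi⟩ := h.exists
    exact (norm_nonneg _).trans hi
  -- Truncation changes `x` only off a set of the ultrafilter, and makes its sup norm at most `c`.
  let y : lp (fun _ : ι => Z) ∞ := ⟨fun i => if ‖x i‖ ≤ c then x i else 0, memℓp_infty ⟨c, by
    rintro _ ⟨i, rfl⟩
    dsimp only
    split_ifs with hi
    · exact hi
    · simpa using hc⟩⟩
  have hxy : mk 𝕜 U x = mk 𝕜 U y := by
    rw [mk_eq_mk]
    refine tendsto_const_nhds.congr' ?_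
    filter_upwards [h] with i hi
    simp [y, hi]
  rw [hxy]
  refine (Submodule.Quotient.norm_mk_le (S := nullFamilies 𝕜 U Z) y).trans (lp.norm_le_of_forall_le hc fun i => ?_)
  dsimp only [y]
  split_ifs with hi
  · exact hi
  · simpa using hc

theorem le_norm_mk {x : lp (fun _ : ι => Z) ∞} {c : ℝ} (h : ∀ᶠ i in (U : Filter ι), c ≤ ‖x i‖) :
    c ≤ ‖(mk 𝕜 U x)‖ := by
  refine le_of_forall_pos_le_add fun ε hε => ?_
  obtain ⟨m, hm, hmn⟩ : ∃ m, mk 𝕜 U m = mk 𝕜 U x ∧ ‖m‖ < ‖mk 𝕜 U x‖ + ε / 2 :=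
    Submodule.Quotient.norm_mk_lt (S := nullFamilies 𝕜 U Z) _ (by positivity)
  rw [mk_eq_mk] at hm
  obtain ⟨i, hi, hi'⟩ := (h.and (Metric.tendsto_nhds.1 hm (ε / 2) (by positivity))).exists
  rw [dist_zero_right] at hi'
  have h1 := lp.norm_apply_le_norm ENNReal.top_ne_zero m i
  have h2 := norm_add_le (x i - m i) (m i)
  rw [sub_add_cancel] at h2
  rw [norm_sub_rev] at h2
  linarith

theorem eventually_norm_le {x : lp (fun _ : ι => Z) ∞} {c : ℝ}
    (h : ‖(mk 𝕜 U x)‖ < c) :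
    ∀ᶠ i in (U : Filter ι), ‖x i‖ ≤ c := by
  by_contra hc
  rw [Ultrafilter.eventually_not.symm] at hc
  exact absurd (le_norm_mk 𝕜 (hc.mono fun i hi => (not_le.1 hi).le)) (not_le.2 h)

theorem eventually_le_norm {x : lp (fun _ : ι => Z) ∞} {c : ℝ}
    (h : c < ‖(mk 𝕜 U x)‖) :
    ∀ᶠ i in (U : Filter ι), c ≤ ‖x i‖ := by
  by_contra hc
  rw [Ultrafilter.eventually_not.symm] at hc
  exact absurd (norm_mk_le 𝕜 (hc.mono fun i hi => (not_le.1 hi).le)) (not_le.2 h)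

variable {𝕜}

/-- An ultrapower of `Z` is, up to a constant, finitely representable in `Z`. -/
theorem kEmbeds (E : Submodule 𝕜 (Ultrapower 𝕜 U Z)) [FiniteDimensional 𝕜 E] :
    KEmbeds 𝕜 4 E Z := by
  have : ProperSpace E := FiniteDimensional.proper 𝕜 E
  obtain ⟨s, hs⟩ := (mk 𝕜 U).exists_rightInverse_of_surjective
    (LinearMap.range_eq_top.2 (mk_surjective 𝕜 (Z := Z)))
  have hs' : ∀ z : Ultrapower 𝕜 U Z, mk 𝕜 U (s z) = z := fun z =>
    LinearMap.congr_fun hs z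
  -- A linear lift of `E` to bounded families is continuous since `E` is finite-dimensional. The net
  -- below is so fine that one index `i` almost preserving norms on it works on the whole sphere.
  let σ : E →L[𝕜] lp (fun _ : ι => Z) ∞ := LinearMap.toContinuousLinearMap (s ∘ₗ E.subtype)
  have hσ : ∀ z : E, (mk 𝕜 U (σ z)) = z := fun z => hs' z
  obtain ⟨t, htf, ht⟩ := Metric.totallyBounded_iff.1
    (isCompact_sphere (0 : E) 1).totallyBounded (1 / (8 * (‖σ‖ + 1))) (by positivity)
  have hev : ∀ᶠ i in (U : Filter ι), ∀ y ∈ t, ‖(y : E)‖ - 1 / 8 ≤ ‖σ y i‖ ∧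
      ‖σ y i‖ ≤ ‖(y : E)‖ + 1 / 8 := by
    refine (eventually_all_finite htf).2 fun y _ => ?_
    refine (eventually_le_norm 𝕜 ?_).and (eventually_norm_le 𝕜 ?_)
    · rw [hσ]; simp
    · rw [hσ]; simp
  obtain ⟨i, hi⟩ := hev.exists
  let g : E →ₗ[𝕜] Z :=
    { toFun := fun z => σ z i
      map_add' := fun x y => by simp
      map_smul' := fun c x => by simp }
  have key : ∀ x : E, ‖x‖ = 1 → 1 / 2 ≤ ‖g x‖ ∧ ‖g x‖ ≤ 2 := by
    intro x hx
    obtain ⟨y, hy, hxy⟩ := Set.mem_iUnion₂.1 (ht (a := x) (by simpa using hx))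
    rw [Metric.mem_ball, dist_eq_norm] at hxy
    have h1 : ‖σ (x - y) i‖ ≤ 1 / 8 := by
      calc ‖σ (x - y) i‖ ≤ ‖σ (x - y)‖ := lp.norm_apply_le_norm ENNReal.top_ne_zero _ i
        _ ≤ ‖σ‖ * ‖x - y‖ := σ.le_opNorm _
        _ ≤ (‖σ‖ + 1) * (1 / (8 * (‖σ‖ + 1))) := by gcongr; linarith
        _ = 1 / 8 := by field_simp
    have h0 : ‖x - y‖ ≤ 1 / 8 := hxy.le.trans (by
      apply one_div_le_one_div_of_le (by norm_num)
      linarith [norm_nonneg σ])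
    have h2 : g (x - y) = g x - g y := map_sub g x y
    have h3 : ‖g x - g y‖ ≤ 1 / 8 := h2 ▸ h1
    have h4 := hi y hy
    change ‖y‖ - 1 / 8 ≤ ‖g y‖ ∧ ‖g y‖ ≤ ‖y‖ + 1 / 8 at h4
    have h5 := abs_le.1 ((abs_norm_sub_norm_le x y).trans h0)
    have h6 := abs_le.1 ((abs_norm_sub_norm_le (g x) (g y)).trans h3)
    constructor <;> linarith [h4.1, h4.2]
  refine ⟨(2 : 𝕜) • g, fun x => ?_⟩
  rcases eq_or_ne x 0 with rfl | hx0
  · simp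
  have hn : (0 : ℝ) < ‖x‖ := norm_pos_iff.2 hx0
  have h := key (((‖x‖⁻¹ : ℝ) : 𝕜) • x) (by
    rw [norm_smul, RCLike.norm_ofReal, abs_of_pos (by positivity)]
    field_simp)
  rw [map_smul, norm_smul, RCLike.norm_ofReal, abs_of_pos (by positivity), inv_mul_eq_div,
    le_div_iff₀ hn, div_le_iff₀ hn] at h
  have h2 : ‖((2 : 𝕜) • g) x‖ = 2 * ‖g x‖ := by simp [norm_smul]
  rw [h2]
  constructor <;> linarith [h.1, h.2]

/-- Vectors that are linearly dependent at each index are linearly dependent in the ultrapower. -/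
theorem not_linearIndependent {κ : Type*} [Fintype κ] (x : κ → lp (fun _ : ι => Z) ∞)
    (h : ∀ i, ¬ LinearIndependent 𝕜 fun l => x l i) :
    ¬ LinearIndependent 𝕜 fun l => (mk 𝕜 U (x l)) := by
  have hc : ∀ i, ∃ c : κ → 𝕜, ‖c‖ = 1 ∧ ∑ l, c l • x l i = 0 := by
    intro i
    obtain ⟨c, hc, l, hl⟩ := Fintype.not_linearIndependent_iff.1 (h i)
    have hc0 : c ≠ 0 := fun h => hl (congrFun h l)
    have hn : (0 : ℝ) < ‖c‖ := norm_pos_iff.2 hc0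
    refine ⟨((‖c‖⁻¹ : ℝ) : 𝕜) • c, ?_, ?_⟩
    · rw [norm_smul, RCLike.norm_ofReal, abs_of_pos (by positivity)]
      field_simp
    · simp only [Pi.smul_apply, smul_assoc]
      rw [← Finset.smul_sum, hc, smul_zero]
  choose c hc1 hc2 using hc
  have hU : ((U.map c : Ultrafilter _) : Filter (κ → 𝕜)) ≤
      𝓟 (Metric.sphere (0 : κ → 𝕜) 1) := by
    rw [le_principal_iff]
    exact Filter.mem_map.2 (Filter.univ_mem' fun i => by simp [hc1])
  -- Normalized coefficients of the dependences converge along `U` by compactness; the limit has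
  -- norm 1, so it is a nontrivial dependence.
  obtain ⟨d, hd, hcd⟩ := (isCompact_sphere (0 : κ → 𝕜) 1).ultrafilter_le_nhds _ hU
  have hcd' : Tendsto c U (𝓝 d) := hcd
  have hd1 : ‖d‖ = 1 := by simpa using hd
  refine Fintype.not_linearIndependent_iff.2 ⟨d, ?_, ?_⟩
  · simp only [← map_smul]
    rw [← map_sum, mk_eq_zero]
    have h0 : ∀ i, ((∑ l, d l • x l : lp (fun _ : ι => Z) ∞) : ∀ _, Z) i =
        ∑ l, (d l - c i l) • x l i := by
      intro i
      simp only [sub_smul, Finset.sum_sub_distrib, hc2, sub_zero]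
      rw [lp.coeFn_sum, Finset.sum_apply]
      simp
    simp only [h0]
    rw [show (0 : Z) = ∑ l : κ, (0 : Z) by simp]
    refine tendsto_finsetSum _ fun l _ => ?_
    have h1 : Tendsto (fun i => ‖d l - c i l‖ * ‖x l‖) U (𝓝 0) := by
      have h2 : Tendsto (fun i => d l - c i l) U (𝓝 0) := by
        have := ((continuous_apply l).tendsto d).comp hcd'
        simpa using this.const_sub (d l)
      simpa using h2.norm.mul_const ‖x l‖
    refine squeeze_zero_norm (fun i => ?_) h1
    rw [norm_smul]
    gcongr
    exact lp.norm_apply_le_norm ENNReal.top_ne_zero _ i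
  · by_contra! hall
    rw [show d = 0 from funext hall] at hd1
    simp at hd1

/-- The operator on the ultrapower induced by a uniformly bounded family of operators. -/
theorem exists_map {lam : ℝ} (u : ι → Z →L[𝕜] Z) (hu : ∀ i, ‖u i‖ ≤ lam) :
    ∃ v : Ultrapower 𝕜 U Z →L[𝕜] Ultrapower 𝕜 U Z, ‖v‖ ≤ lam ∧
      ∀ x, ∃ y : lp (fun _ : ι => Z) ∞, (∀ i, y i = u i (x i)) ∧
        v (mk 𝕜 U x) = mk 𝕜 U y := by
  have hb : ∀ i z, ‖u i z‖ ≤ lam * ‖z‖ := fun i z => (u i).le_of_opNorm_le (hu i) z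
  obtain ⟨i₀, -⟩ := (U.neBot.nonempty_of_mem Filter.univ_mem)
  have hl : 0 ≤ lam := (norm_nonneg _).trans (hu i₀)
  let D : lp (fun _ : ι => Z) ∞ →ₗ[𝕜] lp (fun _ : ι => Z) ∞ :=
    { toFun := fun x => ⟨fun i => u i (x i), memℓp_infty ⟨lam * ‖x‖, by
        rintro _ ⟨i, rfl⟩
        refine (hb i _).trans ?_
        gcongr
        exact lp.norm_apply_le_norm ENNReal.top_ne_zero _ i⟩⟩
      map_add' := fun x y => by ext i; exact map_add (u i) _ _
      map_smul' := fun c x => by ext i; exact map_smul (u i) _ _ }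
  have hDi : ∀ x i, D x i = u i (x i) := fun x i => rfl
  have hD : nullFamilies 𝕜 U Z ≤ (nullFamilies 𝕜 U Z).comap D := by
    intro x hx
    rw [Submodule.mem_comap, mem_nullFamilies]
    refine squeeze_zero_norm (fun i => hb i (x i)) ?_
    simpa using (((mem_nullFamilies 𝕜).1 hx).norm.const_mul lam)
  let D' : Ultrapower 𝕜 U Z →ₗ[𝕜] Ultrapower 𝕜 U Z := (nullFamilies 𝕜 U Z).mapQ _ D hD
  refine ⟨LinearMap.mkContinuous D' lam fun z => ?_,
    LinearMap.mkContinuous_norm_le _ hl _, fun x => ⟨D x, hDi x, rfl⟩⟩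
  obtain ⟨x, rfl⟩ := mk_surjective 𝕜 z
  change ‖mk 𝕜 U (D x)‖ ≤ _
  refine le_of_forall_pos_le_add fun ε hε => ?_
  refine norm_mk_le 𝕜 ?_
  filter_upwards [eventually_norm_le 𝕜 (lt_add_of_pos_right
    ‖(mk 𝕜 U x)‖ (show 0 < ε / (lam + 1) by positivity))]
    with i hi
  rw [hDi]
  refine (hb i _).trans ?_
  have h1 : lam * (ε / (lam + 1)) ≤ ε := by
    rw [mul_div_assoc', div_le_iff₀ (by positivity)]
    nlinarith
  have h2 := mul_le_mul_of_nonneg_left hi hl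
  rw [mul_add] at h2
  linarith

/-- The uniform approximation property gives the bounded approximation property of the
ultrapowers. -/
theorem exists_finiteRank {lam : ℝ} (hZ : HasUAPWith 𝕜 Z lam) (t : Finset (Ultrapower 𝕜 U Z)) :
    ∃ v : Ultrapower 𝕜 U Z →L[𝕜] Ultrapower 𝕜 U Z, ‖v‖ ≤ lam ∧ (∀ z ∈ t, v z = z) ∧
      FiniteDimensional 𝕜 (LinearMap.range (v : Ultrapower 𝕜 U Z →ₗ[𝕜] Ultrapower 𝕜 U Z)) := by
  classical
  obtain ⟨f, hf⟩ := hZ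
  choose s hs using mk_surjective 𝕜 (U := U) (Z := Z)
  let A : ι → Submodule 𝕜 Z := fun i => Submodule.span 𝕜 (t.image fun z => s z i)
  have hAfd : ∀ i, FiniteDimensional 𝕜 (A i) := fun i =>
    FiniteDimensional.span_finset 𝕜 _
  have hA : ∀ i, Module.finrank 𝕜 (A i) ≤ t.card := fun i =>
    (finrank_span_finset_le_card _).trans Finset.card_image_le
  choose u hu1 hu2 hu3 hu4 using fun i => hf (A i) (hAfd i)
  -- `f` need not be monotone, so its maximum over all possible dimensions is taken.
  let r := (Finset.range (t.card + 1)).sup f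
  have hr : ∀ i, Module.finrank 𝕜 (LinearMap.range (u i : Z →ₗ[𝕜] Z)) ≤ r := fun i =>
    (hu4 i).trans (Finset.le_sup (Finset.mem_range.2 (Nat.lt_succ_of_le (hA i))))
  obtain ⟨v, hv1, hv2⟩ := exists_map (U := U) u fun i => (hu2 i).le
  refine ⟨v, hv1, fun z hz => ?_, ?_⟩
  · obtain ⟨y, hy, hvy⟩ := hv2 (s z)
    rw [hs] at hvy
    rw [hvy]
    have : y = s z := by
      ext i
      rw [hy, hu1 i _ (Submodule.subset_span (by
        exact Finset.mem_coe.2 (Finset.mem_image_of_mem (fun z => s z i) hz)))]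
    rw [this, hs]
  -- More than `r` vectors in the range of `v` lift to families lying at each index in a space of
  -- dimension at most `r`, so they are dependent.
  · refine Module.rank_lt_aleph0_iff.1 (lt_of_le_of_lt (rank_le (n := r) fun w hw => ?_)
      Cardinal.natCast_lt_aleph0)
    by_contra! hcard
    have hw' := hw.map' (Submodule.subtype _) (Submodule.ker_subtype _)
    have hy : ∀ l : w, ∃ y : lp (fun _ : ι => Z) ∞,
        (∀ i, y i ∈ LinearMap.range (u i : Z →ₗ[𝕜] Z)) ∧ mk 𝕜 U y = l.1.1 := by
      rintro ⟨⟨_, z, rfl⟩, -⟩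
      obtain ⟨x, rfl⟩ := mk_surjective 𝕜 z
      obtain ⟨y, hy, hvy⟩ := hv2 x
      exact ⟨y, fun i => hy i ▸ LinearMap.mem_range_self _ _, hvy.symm⟩
    choose y hy1 hy2 using hy
    refine not_linearIndependent (𝕜 := 𝕜) (U := U) y (fun i hi => ?_) ?_
    · have := hu3 i
      have hi' : LinearIndependent 𝕜 fun l =>
          (⟨y l i, hy1 l i⟩ : LinearMap.range (u i : Z →ₗ[𝕜] Z)) :=
        LinearIndependent.of_comp (Submodule.subtype _) hi
      have h1 := hi'.fintype_card_le_finrank.trans (hr i)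
      rw [Fintype.card_coe] at h1
      omega
    · simp only [hy2]
      exact hw'

/-- A space finitely representable in `Z` embeds in an ultrapower of `Z`. -/
theorem _root_.FinRep.exists_embedding {Y : Type*} [NormedAddCommGroup Y] [NormedSpace 𝕜 Y]
    (h : FinRep 𝕜 Y Z) : ∃ U : Ultrafilter (Finset Y), ∃ J : Y →ₗ[𝕜] Ultrapower 𝕜 U Z,
      ∀ y, ‖y‖ ≤ ‖J y‖ ∧ ‖J y‖ ≤ 2 * ‖y‖ := by
  classical
  have hg : ∀ F : Finset Y, ∃ g : Submodule.span 𝕜 (F : Set Y) →ₗ[𝕜] Z,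
      ∀ x, ‖x‖ ≤ ‖g x‖ ∧ ‖g x‖ ≤ 2 * ‖x‖ := fun F => by
    have := h.kEmbeds (E := Submodule.span 𝕜 (F : Set Y)) (K := 1)
      ⟨Submodule.subtype _, fun x => by simp⟩
    simpa [KEmbeds] using this
  choose g hg using hg
  let U : Ultrafilter (Finset Y) := Ultrafilter.of (atTop : Filter (Finset Y))
  have hU : ∀ y : Y, ∀ᶠ F : Finset Y in (U : Filter (Finset Y)), y ∈ Submodule.span 𝕜 (F : Set Y) :=
    fun y => Ultrafilter.of_le (atTop : Filter (Finset Y)) <| (eventually_ge_atTop ({y} : Finset Y)).mono fun F hF =>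
      Submodule.subset_span (Finset.mem_coe.2 (hF (Finset.mem_singleton_self y)))
  -- The value 0 off the span is harmless: every `y` lies in the span of `F` for `U`-almost all `F`,
  -- so linearity holds in the quotient.
  let j : Y → Finset Y → Z := fun y F =>
    if hy : y ∈ Submodule.span 𝕜 (F : Set Y) then g F ⟨y, hy⟩ else 0
  have hj : ∀ y (F : Finset Y) (hy : y ∈ Submodule.span 𝕜 (F : Set Y)), j y F = g F ⟨y, hy⟩ :=
    fun y F hy => dif_pos hy
  let J₀ : Y → lp (fun _ : Finset Y => Z) ∞ := fun y => ⟨j y, memℓp_infty ⟨2 * ‖y‖, by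
    rintro _ ⟨F, rfl⟩
    by_cases hy : y ∈ Submodule.span 𝕜 (F : Set Y)
    · dsimp only
      rw [hj y F hy]
      exact (hg F _).2
    · simp [j, hy]⟩⟩
  have hJ₀ : ∀ y F, J₀ y F = j y F := fun y F => rfl
  let J : Y →ₗ[𝕜] Ultrapower 𝕜 U Z :=
    { toFun := fun y => mk 𝕜 U (J₀ y)
      map_add' := fun x y => by
        rw [← map_add, mk_eq_mk]
        refine tendsto_const_nhds.congr' ?_
        filter_upwards [hU x, hU y] with F hx hy
        simp only [lp.coeFn_add, Pi.add_apply, hJ₀]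
        rw [hj _ F hx, hj _ F hy, hj _ F (Submodule.add_mem _ hx hy), ← map_add, ← map_sub]
        simp
      map_smul' := fun c x => by
        rw [RingHom.id_apply, ← map_smul, mk_eq_mk]
        refine tendsto_const_nhds.congr' ?_
        filter_upwards [hU x] with F hx
        simp only [lp.coeFn_smul, Pi.smul_apply, hJ₀]
        rw [hj _ F hx, hj _ F (Submodule.smul_mem _ c hx), ← map_smul, ← map_sub]
        simp }
  refine ⟨U, J, fun y => ⟨le_norm_mk 𝕜 ?_, norm_mk_le 𝕜 ?_⟩⟩
  · filter_upwards [hU y] with F hy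
    rw [hJ₀, hj _ F hy]
    exact (hg F ⟨y, hy⟩).1
  · filter_upwards [hU y] with F hy
    rw [hJ₀, hj _ F hy]
    exact (hg F ⟨y, hy⟩).2

end Ultrapower

end Ultrapower

/-! ### Series of finite-rank operators and compact factorization -/

section Factorization

open Filter Topology

variable {𝕜 : Type*} [RCLike 𝕜] {X : Type*} [NormedAddCommGroup X] [NormedSpace 𝕜 X]
  {Y : Type*} [NormedAddCommGroup Y] [NormedSpace 𝕜 Y]
  {Z : Type*} [NormedAddCommGroup Z] [NormedSpace 𝕜 Z]
  {H : Type*} [NormedAddCommGroup H] [NormedSpace 𝕜 H]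

theorem isCompactOperator_subtype_comp (E : Submodule 𝕜 H) [FiniteDimensional 𝕜 E]
    (f : X →L[𝕜] E) : IsCompactOperator (E.subtypeL.comp f) := by
  have : ProperSpace E := FiniteDimensional.proper 𝕜 E
  exact (isCompactOperator_of_locallyCompactSpace_dom f).clm_comp E.subtypeL

theorem exists_compact_series [CompleteSpace H] {f : ℕ → X →L[𝕜] H} {c : ℝ}
    (hf : ∀ n, IsCompactOperator (f n)) (hc : ∀ n, ‖f n‖ ≤ c * (1 / 2) ^ n) :
    ∃ g : X →L[𝕜] H, IsCompactOperator g ∧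
      ∀ x, Tendsto (fun n => ∑ k ∈ Finset.range n, f k x) atTop (𝓝 (g x)) := by
  have hs : Summable f := Summable.of_norm_bounded (summable_geometric_two.mul_left c) hc
  have ht := hs.hasSum.tendsto_sum_nat
  refine ⟨∑' n, f n, isCompactOperator_of_tendsto ht (Eventually.of_forall fun n => ?_),
    fun x => ?_⟩
  · exact Submodule.sum_mem (compactOperator (RingHom.id 𝕜) X H) fun k _ => hf k
  · have := ((ContinuousLinearMap.apply 𝕜 H x).continuous.tendsto _).comp ht
    simpa [Function.comp_def] using this

/-- An operator which is a norm limit of finite rank operators is the sum of a rapidly convergent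
series of finite rank operators. -/
theorem exists_series_of_approx {K : X →L[𝕜] H}
    (h : ∀ ε : ℝ, 0 < ε → ∃ S : X →L[𝕜] H, FiniteDimensional 𝕜 (LinearMap.range (S : X →ₗ[𝕜] H)) ∧
      ‖K - S‖ ≤ ε) :
    ∃ (T : ℕ → X →L[𝕜] H) (M : ℝ),
      (∀ n, FiniteDimensional 𝕜 (LinearMap.range (T n : X →ₗ[𝕜] H))) ∧
      (∀ n, ‖T n‖ ≤ M * (1 / 4) ^ n) ∧
      ∀ x, Tendsto (fun n => ∑ k ∈ Finset.range n, T k x) atTop (𝓝 (K x)) := by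
  choose S hS hKS using fun n : ℕ => h ((1 / 4) ^ n) (by positivity)
  let T : ℕ → X →L[𝕜] H := fun n => Nat.casesOn n (S 0) fun n => S (n + 1) - S n
  have hsum : ∀ n, ∑ k ∈ Finset.range (n + 1), T k = S n := by
    intro n
    induction n with
    | zero => simp [T]
    | succ n ih => rw [Finset.sum_range_succ, ih]; simp [T]
  -- Successive differences are at most `5 / 4 ^ (n + 1)`, so 8 is ample; `‖S 0‖` covers `n = 0`.
  refine ⟨T, max ‖S 0‖ 8, fun n => ?_, fun n => ?_, fun x => ?_⟩
  · cases n with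
    | zero => exact hS 0
    | succ n =>
      have := hS n
      have := hS (n + 1)
      refine Submodule.finiteDimensional_of_le (S₂ := LinearMap.range (S (n + 1) : X →ₗ[𝕜] H) ⊔
        LinearMap.range (S n : X →ₗ[𝕜] H)) ?_
      rintro _ ⟨x, rfl⟩
      exact Submodule.sub_mem _ (Submodule.mem_sup_left ⟨x, rfl⟩)
        (Submodule.mem_sup_right ⟨x, rfl⟩)
  · cases n with
    | zero => simp [T]
    | succ n =>
      have h1 : T (n + 1) = (K - S n) - (K - S (n + 1)) := by simp [T]
      calc ‖T (n + 1)‖ ≤ ‖K - S n‖ + ‖K - S (n + 1)‖ := h1 ▸ norm_sub_le _ _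
        _ ≤ (1 / 4) ^ n + (1 / 4) ^ (n + 1) := add_le_add (hKS n) (hKS (n + 1))
        _ ≤ 8 * (1 / 4) ^ (n + 1) := by
          rw [pow_succ]
          have : (0 : ℝ) < (1 / 4) ^ n := by positivity
          linarith
        _ ≤ _ := by gcongr; exact le_max_right _ _
  · rw [← tendsto_add_atTop_iff_nat 1]
    have h1 : ∀ n, ∑ k ∈ Finset.range (n + 1), T k x = S n x := fun n => by
      rw [← hsum n, sum_apply]
    simp only [h1]
    rw [tendsto_iff_norm_sub_tendsto_zero]
    have h0 : Tendsto (fun n : ℕ => ((1 / 4 : ℝ)) ^ n * ‖x‖) atTop (𝓝 0) := by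
      simpa using (tendsto_pow_atTop_nhds_zero_of_lt_one (by norm_num : (0 : ℝ) ≤ 1 / 4)
        (by norm_num)).mul_const ‖x‖
    refine squeeze_zero (fun _ => norm_nonneg _) (fun n => ?_) h0
    rw [norm_sub_rev]
    exact (K - S n).le_of_opNorm_le (hKS n) x

/-- If `v` fixes a fine net of the image of the unit ball, then `v ∘ K` is uniformly close to `K`
there, because `‖v‖ ≤ lam`. -/
theorem IsCompactOperator.exists_finiteRank_approx {K : X →L[𝕜] H} (hK : IsCompactOperator K)
    {lam : ℝ} (h : ∀ t : Finset H, ∃ v : H →L[𝕜] H, ‖v‖ ≤ lam ∧ (∀ z ∈ t, v z = z) ∧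
      FiniteDimensional 𝕜 (LinearMap.range (v : H →ₗ[𝕜] H))) {ε : ℝ} (hε : 0 < ε) :
    ∃ S : X →L[𝕜] H, FiniteDimensional 𝕜 (LinearMap.range (S : X →ₗ[𝕜] H)) ∧ ‖K - S‖ ≤ ε := by
  have hl : 0 ≤ lam := by
    obtain ⟨v, hv, -⟩ := h ∅
    exact (norm_nonneg _).trans hv
  obtain ⟨C, hC, hCK⟩ := hK.image_closedBall_subset_compact (f := (K : X →ₗ[𝕜] H)) 1
  obtain ⟨t, htf, ht⟩ := Metric.totallyBounded_iff.1 hC.totallyBounded (ε / (1 + lam))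
    (by positivity)
  obtain ⟨v, hv, hvt, hvfd⟩ := h htf.toFinset
  refine ⟨v.comp K, Submodule.finiteDimensional_of_le
    (S₂ := LinearMap.range (v : H →ₗ[𝕜] H)) ?_, ?_⟩
  · rintro _ ⟨x, rfl⟩
    exact ⟨K x, rfl⟩
  refine ContinuousLinearMap.opNorm_le_of_unit_norm hε.le fun x hx => ?_
  have hxC : K x ∈ C := hCK ⟨x, by simp [hx], rfl⟩
  obtain ⟨y, hy, hxy⟩ := Set.mem_iUnion₂.1 (ht hxC)
  rw [Metric.mem_ball, dist_eq_norm] at hxy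
  have h1 : (K - v.comp K) x = (K x - y) - v (K x - y) := by
    rw [map_sub, hvt y (htf.mem_toFinset.2 hy)]
    simp
  rw [h1]
  calc ‖(K x - y) - v (K x - y)‖ ≤ ‖K x - y‖ + lam * ‖K x - y‖ :=
        (norm_sub_le _ _).trans (by gcongr; exact v.le_of_opNorm_le hv _)
    _ = (1 + lam) * ‖K x - y‖ := by ring
    _ ≤ (1 + lam) * (ε / (1 + lam)) := by gcongr
    _ = ε := by field_simp

theorem exists_continuous_leftInverse [CompleteSpace Y] {J : Y →L[𝕜] H}
    (hJ : ∀ y, ‖y‖ ≤ ‖J y‖) :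
    IsClosed (LinearMap.range (J : Y →ₗ[𝕜] H) : Set H) ∧
      ∃ L : LinearMap.range (J : Y →ₗ[𝕜] H) →L[𝕜] Y, ∀ z, J (L z) = z := by
  have ha : AntilipschitzWith 1 J := J.antilipschitz_of_bound fun y => by simpa using hJ y
  refine ⟨ha.isClosed_range J.uniformContinuous, ?_⟩
  let L := (LinearEquiv.ofInjective (J : Y →ₗ[𝕜] H) ha.injective).symm
  have hL : ∀ z, J (L z) = z := fun z => congrArg Subtype.val
    ((LinearEquiv.ofInjective (J : Y →ₗ[𝕜] H) ha.injective).apply_symm_apply z)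
  refine ⟨LinearMap.mkContinuous L.toLinearMap 1 fun z => ?_, hL⟩
  have := hJ (L z)
  rw [hL] at this
  simpa using this

/-- A compact operator which, after an embedding of its target, is a rapidly convergent series of
finite rank operators `S n`, factors compactly through a subspace of `Z` as soon as copies of the
ranges of the `S n` form a Schauder decomposition in `Z`. -/
theorem exists_kFactorization [CompleteSpace Y] [CompleteSpace Z] [CompleteSpace H]
    {T : X →L[𝕜] Y} {J : Y →L[𝕜] H} (hJ : ∀ y, ‖y‖ ≤ ‖J y‖) {S : ℕ → X →L[𝕜] H} {M C : ℝ}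
    (hC : 0 ≤ C) [∀ n, FiniteDimensional 𝕜 (LinearMap.range (S n : X →ₗ[𝕜] H))]
    (hSn : ∀ n, ‖S n‖ ≤ M * (1 / 4) ^ n)
    (hST : ∀ x, Tendsto (fun n => ∑ k ∈ Finset.range n, S k x) atTop (𝓝 (J (T x))))
    (e : ∀ n, LinearMap.range (S n : X →ₗ[𝕜] H) →ₗ[𝕜] Z)
    (he : ∀ n x, ‖x‖ ≤ ‖e n x‖ ∧ ‖e n x‖ ≤ C * ‖x‖)
    (hd : ∀ x : ∀ n, LinearMap.range (S n : X →ₗ[𝕜] H), ∀ n m, n ≤ m →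
      ‖∑ k ∈ Finset.range n, e k (x k)‖ ≤ 2 * ‖∑ k ∈ Finset.range m, e k (x k)‖) :
    ∃ W : Submodule 𝕜 Z, IsClosed (W : Set Z) ∧ HasKFactorization T W := by
  let E : ℕ → Submodule 𝕜 H := fun n => LinearMap.range (S n : X →ₗ[𝕜] H)
  have hE : ∀ n, FiniteDimensional 𝕜 (E n) := fun n => inferInstance
  have hEp : ∀ n, ProperSpace (E n) := fun n => FiniteDimensional.proper 𝕜 (E n)
  let S' : ∀ n, X →L[𝕜] E n := fun n => (S n).codRestrict (E n) fun x => ⟨x, rfl⟩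
  have hS' : ∀ n x, ‖S' n x‖ = ‖S n x‖ := fun n x => rfl
  -- The weight `2 ^ n` splits the decay `4 ^ (-n)` evenly: `2 ^ (-n)` for the series of `u`, and `2
  -- ^ (-n)` for that of `v`.
  let a : ∀ n, X →L[𝕜] Z := fun n =>
    (2 ^ n : 𝕜) • (LinearMap.toContinuousLinearMap (e n)).comp (S' n)
  have ha : ∀ n x, a n x = e n ((2 ^ n : 𝕜) • S' n x) := fun n x => by simp [a]
  have hac : ∀ n, IsCompactOperator (a n) := fun n =>
    ((isCompactOperator_of_locallyCompactSpace_dom (S' n)).clm_comp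
      (LinearMap.toContinuousLinearMap (e n))).smul (2 ^ n : 𝕜)
  have hpow : ∀ n : ℕ, (2 : ℝ) ^ n * (1 / 4) ^ n = (1 / 2) ^ n := fun n => by
    rw [← mul_pow]; norm_num
  have han : ∀ n, ‖a n‖ ≤ (C * M) * (1 / 2) ^ n := by
    intro n
    have hM : 0 ≤ M * (1 / 4) ^ n := (norm_nonneg _).trans (hSn n)
    refine ContinuousLinearMap.opNorm_le_bound _ ?_ fun x => ?_
    · rw [← hpow, show C * M * (2 ^ n * (1 / 4) ^ n) = C * 2 ^ n * (M * (1 / 4) ^ n) by ring]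
      positivity
    · rw [ha]
      calc ‖e n ((2 ^ n : 𝕜) • S' n x)‖ ≤ C * ‖(2 ^ n : 𝕜) • S' n x‖ := (he n _).2
        _ = C * (2 ^ n * ‖S n x‖) := by rw [norm_smul, hS']; simp
        _ ≤ C * (2 ^ n * (M * (1 / 4) ^ n * ‖x‖)) := by
          gcongr
          exact (S n).le_of_opNorm_le (hSn n) x
        _ = C * M * (1 / 2) ^ n * ‖x‖ := by rw [← hpow]; ring
  obtain ⟨u, huc, hu⟩ := exists_compact_series hac han
  -- The `n`-th term is a difference of two partial sums, each at most twice a later one; this gives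
  -- the 4.
  have hSu : ∀ n x, ‖S n x‖ ≤ 4 * (1 / 2) ^ n * ‖u x‖ := by
    intro n x
    have h1 : ∀ m, n + 1 ≤ m → 2 ^ n * ‖S n x‖ ≤ 4 * ‖∑ k ∈ Finset.range m, a k x‖ := by
      intro m hm
      have h2 := hd (fun k => (2 ^ k : 𝕜) • S' k x) n m (by omega)
      have h3 := hd (fun k => (2 ^ k : 𝕜) • S' k x) (n + 1) m hm
      simp only [← ha] at h2 h3
      have h4 : ‖a n x‖ ≤ ‖∑ k ∈ Finset.range (n + 1), a k x‖ +
          ‖∑ k ∈ Finset.range n, a k x‖ := by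
        have : a n x = ∑ k ∈ Finset.range (n + 1), a k x - ∑ k ∈ Finset.range n, a k x := by
          rw [Finset.sum_range_succ]; abel
        exact this ▸ norm_sub_le _ _
      have h5 : 2 ^ n * ‖S n x‖ ≤ ‖a n x‖ := by
        rw [ha]
        refine le_trans (le_of_eq ?_) (he n _).1
        rw [norm_smul, hS']; simp
      linarith
    have h6 : 2 ^ n * ‖S n x‖ ≤ 4 * ‖u x‖ :=
      ge_of_tendsto ((hu x).norm.const_mul 4) ((eventually_ge_atTop (n + 1)).mono h1)
    calc ‖S n x‖ = (1 / 2) ^ n * (2 ^ n * ‖S n x‖) := by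
          rw [← mul_assoc, ← mul_pow]; norm_num
      _ ≤ (1 / 2) ^ n * (4 * ‖u x‖) := by gcongr
      _ = 4 * (1 / 2) ^ n * ‖u x‖ := by ring
  let W : Submodule 𝕜 Z := (LinearMap.range (u : X →ₗ[𝕜] Z)).topologicalClosure
  have hW : IsClosed (W : Set Z) := Submodule.isClosed_topologicalClosure _
  have huW : ∀ x, u x ∈ W := fun x => Submodule.le_topologicalClosure _ ⟨x, rfl⟩
  let u₀ : X →L[𝕜] W := u.codRestrict W huW
  have hu₀ : DenseRange u₀ := by
    intro w
    rw [Topology.IsInducing.subtypeVal.closure_eq_preimage_closure_image]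
    have h1 : (Subtype.val '' Set.range u₀ : Set Z) =
        (LinearMap.range (u : X →ₗ[𝕜] Z) : Set Z) := by
      rw [← Set.range_comp]; rfl
    exact (congrArg closure h1).ge w.2
  -- By `hSu`, `u x ↦ S n x` is well defined and bounded on the dense range of `u₀`, so it extends
  -- to `W`.
  let R : ∀ n, W →L[𝕜] E n := fun n => LinearMap.extendOfNorm (S' n : X →ₗ[𝕜] E n)
    (u₀ : X →ₗ[𝕜] W)
  have hRb : ∀ n x, ‖(S' n : X →ₗ[𝕜] E n) x‖ ≤ 4 * (1 / 2) ^ n * ‖(u₀ : X →ₗ[𝕜] W) x‖ := hSu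
  have hR : ∀ n x, R n (u₀ x) = S' n x := fun n x =>
    LinearMap.extendOfNorm_eq (e := (u₀ : X →ₗ[𝕜] W)) hu₀ ⟨_, hRb n⟩ x
  have hRn : ∀ n, ‖(E n).subtypeL.comp (R n)‖ ≤ 4 * (1 / 2) ^ n := fun n =>
    ContinuousLinearMap.opNorm_le_bound _ (by positivity) fun w =>
      LinearMap.norm_extendOfNorm_apply_le (e := (u₀ : X →ₗ[𝕜] W)) hu₀ _ (hRb n) w
  obtain ⟨v, hvc, hv⟩ := exists_compact_series
    (fun n => isCompactOperator_subtype_comp (E n) (R n)) hRn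
  have hvu : ∀ x, v (u₀ x) = J (T x) := fun x => by
    refine tendsto_nhds_unique (hv (u₀ x)) ((hST x).congr fun n => Finset.sum_congr rfl ?_)
    intro k _
    change S k x = ((R k (u₀ x) : E k) : H)
    rw [hR]
    rfl
  obtain ⟨hJc, L, hL⟩ := exists_continuous_leftInverse hJ
  -- On the dense range of `u₀`, `v` takes values in the range of `J`, which is closed.
  have hvJ : ∀ w, v w ∈ LinearMap.range (J : Y →ₗ[𝕜] H) := fun w =>
    hu₀.induction_on (p := fun w => v w ∈ LinearMap.range (J : Y →ₗ[𝕜] H)) w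
      (hJc.preimage v.continuous) fun x => ⟨T x, (hvu x).symm⟩
  refine ⟨W, hW, u₀, L.comp (v.codRestrict _ hvJ), huc.codRestrict huW hW,
    (hvc.codRestrict hvJ hJc).clm_comp L, ?_⟩
  ext x
  have hinj : ∀ y y', J y = J y' → y = y' := fun y y' h => by
    have := hJ (y - y')
    rw [map_sub, h, sub_self, norm_zero] at this
    exact sub_eq_zero.1 (norm_le_zero_iff.1 this)
  refine hinj _ _ ?_
  rw [← hvu]
  exact hL _

end Factorization

/-! ### The factorization theorem -/

theorem theorem6 {𝕜 : Type*} [RCLike 𝕜]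
    {X : Type*} [NormedAddCommGroup X] [NormedSpace 𝕜 X] [CompleteSpace X]
    {Y : Type*} [NormedAddCommGroup Y] [NormedSpace 𝕜 Y] [CompleteSpace Y]
    {Z : Type*} [NormedAddCommGroup Z] [NormedSpace 𝕜 Z] [CompleteSpace Z]
    (hUAP : HasUAP 𝕜 Z) (hYZ : FinRep 𝕜 Y Z) (hZ : FinDecomposableClass 𝕜 Z)
    (T : X →L[𝕜] Y) (hT : IsCompactOperator T) :
    ∃ W : Submodule 𝕜 Z, IsClosed (W : Set Z) ∧ HasKFactorization T W := by
  obtain ⟨lam, hlam⟩ := hUAP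
  obtain ⟨W, _, _, _, ⟨hZW, hWZ⟩, hW⟩ := hZ
  obtain ⟨U, J₀, hJ₀⟩ := hYZ.exists_embedding
  let J : Y →L[𝕜] Ultrapower 𝕜 U Z := J₀.mkContinuous 2 fun y => (hJ₀ y).2
  obtain ⟨S, M, hfd, hSn, hST⟩ := exists_series_of_approx (K := J.comp T) fun ε hε =>
    IsCompactOperator.exists_finiteRank_approx (hT.clm_comp J)
      (Ultrapower.exists_finiteRank hlam) hε
  obtain ⟨C, hC, hCW⟩ := hW.exists_kEmbeds
  -- Distortions multiply: 4 from the ultrapower to `Z`, 2 from `Z` to `W`, `C` into subspaces of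
  -- `W`, then `16 · + 1` back to those of `Z`.
  obtain ⟨e, he, hd⟩ := exists_decomposition (Z := Z) (C := 16 * (C * (2 * 4)) + 1)
    (E := fun n => LinearMap.range (S n : X →ₗ[𝕜] Ultrapower 𝕜 U Z)) fun n V hV hV' =>
      hWZ.kEmbeds_finiteCodimension (by positivity)
        (hCW _ _ (hZW.kEmbeds (Ultrapower.kEmbeds _))) V hV hV'
  exact exists_kFactorization (J := J) (fun y => (hJ₀ y).1) (by positivity) hSn hST e he hd
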